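/- A **hyperbola structure** $(\mathcal P,\Lambda,\Sigma_1\cup\Sigma_2)$ consists of a non-empty set $\mathcal P$ of points and non-empty sets $\Lambda,\Sigma_1,\Sigma_2$ of subsets of $\mathcal P$ with $\Sigma_1\cap\Sigma_2=\emptyset$ (the elements of $\Lambda$ are called circles, those of $\Sigma_1\cup\Sigma_2$ generators) such that * (H1) for each point $p$ and $i\in\{1,2\}$ there is exactly one generator $[p]_i\in\Sigma_i$ containing $p$; * (H2) any $A\in\Sigma_1$, $B\in\Sigma_2$ intersect in exactly one point; * (H3) every generator intersects every circle in exactly one point; * (H4) any three distinct points $a,b,c$ with $[a]_i\neq[b]_i\neq[c]_i\neq[a]_i$ for both $i=1,2$ lie on exactly one circle; * (H5) some circle contains at least three points. For points $p,q$ and a circle $K$ let $pq$ be the point of $[p]_1\cap[q]_2$, let $pK$ be the point of $K\cap[p]_1$ and $Kp$ the point of $K\cap[p]_2$. Let $S_K(p)$ be the unique point $q$ with $pq,qp\in K$. Two different circles $K,L$ are orthogonal, $K\perp L$, if $S_K(p)\in L$ for every $p\in L$. Points are concyclic if some circle contains all of them. Consider the following axioms. * (S) For any circles $K,L$ and any point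 $p\in L\setminus K$, if $S_K(p)\in L$, then $K\perp L$. * (G) If $p_1,\dots,p_4$ are distinct concyclic points and $q_1,\dots,q_4$ are distinct concyclic points such that the points $p_1q_1,\dots,p_4q_4$ are concyclic, then the points $q_1p_1,\dots,q_4p_4$ are concyclic. For circles $E,K$ let $f_K\colon E\to E$ be the permutation $f_K(x)=(Kx)E$, where $(Kx)E$ is the point of $E\cap[Kx]_1$. **Theorem.** Every hyperbola structure satisfying (S) (that is, every symmetric Minkowski plane) satisfies (G), and in it, for every circle $E$, the set $\{f_K : K\in\Lambda\}$ of permutations of $E$ is closed under composition. Moreover, in every hyperbola structure and for every circle $E$, (G) holds if and only if $\{f_K : K\in\Lambda\}$ is closed under composition. -/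

import Mathlib

/-- A hyperbola structure on the point set `P`. Circles and generators are sets of points;
`gens 0` and `gens 1` are the two classes `Σ₁` and `Σ₂` of generators. -/
structure HyperbolaStructure (P : Type*) where
  circles : Set (Set P)
  gens : Fin 2 → Set (Set P)
  disjoint_gens : gens 0 ∩ gens 1 = ∅
  /-- Through each point there is exactly one generator of each class. -/
  H1 : ∀ (p : P) (i : Fin 2), ∃! G : Set P, G ∈ gens i ∧ p ∈ G
  /-- Generators of different classes meet in exactly one point. -/
  H2 : ∀ A ∈ gens 0, ∀ B ∈ gens 1, ∃! p : P, p ∈ A ∧ p ∈ B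
  /-- Every generator meets every circle in exactly one point. -/
  H3 : ∀ (i : Fin 2), ∀ G ∈ gens i, ∀ C ∈ circles, ∃! p : P, p ∈ G ∧ p ∈ C
  /-- Three distinct points whose generators of each class are pairwise different lie on
  exactly one circle. -/
  H4 : ∀ a b c : P, a ≠ b → b ≠ c → c ≠ a →
    (∀ (i : Fin 2), ∀ A ∈ gens i, ∀ B ∈ gens i, ∀ C ∈ gens i,
      a ∈ A → b ∈ B → c ∈ C → A ≠ B ∧ B ≠ C ∧ C ≠ A) →
    ∃! C : Set P, C ∈ circles ∧ a ∈ C ∧ b ∈ C ∧ c ∈ C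
  /-- Some circle has at least three points. -/
  H5 : ∃ C ∈ circles, ∃ a ∈ C, ∃ b ∈ C, ∃ c ∈ C, a ≠ b ∧ b ≠ c ∧ c ≠ a

namespace HyperbolaStructure

noncomputable section

variable {P : Type*} (M : HyperbolaStructure P)

/-- The generator `[p]` of class `i` through `p`. -/
def gen (i : Fin 2) (p : P) : Set P := (M.H1 p i).choose

theorem gen_mem (i : Fin 2) (p : P) : M.gen i p ∈ M.gens i := (M.H1 p i).choose_spec.1.1

theorem mem_gen (i : Fin 2) (p : P) : p ∈ M.gen i p := (M.H1 p i).choose_spec.1.2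

theorem eq_gen {i : Fin 2} {p : P} {G : Set P} (hG : G ∈ M.gens i) (hp : p ∈ G) :
    G = M.gen i p := (M.H1 p i).choose_spec.2 G ⟨hG, hp⟩

theorem gen_eq_of_mem {i : Fin 2} {p q : P} (h : p ∈ M.gen i q) : M.gen i p = M.gen i q :=
  (M.eq_gen (M.gen_mem i q) h).symm

/-- The point `pq = [p]₁ ∩ [q]₂`. -/
def corner (p q : P) : P := (M.H2 _ (M.gen_mem 0 p) _ (M.gen_mem 1 q)).choose

theorem corner_mem_left (p q : P) : M.corner p q ∈ M.gen 0 p :=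
  (M.H2 _ (M.gen_mem 0 p) _ (M.gen_mem 1 q)).choose_spec.1.1

theorem corner_mem_right (p q : P) : M.corner p q ∈ M.gen 1 q :=
  (M.H2 _ (M.gen_mem 0 p) _ (M.gen_mem 1 q)).choose_spec.1.2

theorem eq_corner {p q x : P} (h0 : x ∈ M.gen 0 p) (h1 : x ∈ M.gen 1 q) :
    x = M.corner p q :=
  (M.H2 _ (M.gen_mem 0 p) _ (M.gen_mem 1 q)).choose_spec.2 x ⟨h0, h1⟩

/-- The point in which the generator of class `i` through `p` meets the circle `K`:
`M.proj K 0 p` is `pK = K ∩ [p]₁` and `M.proj K 1 p` is `Kp = K ∩ [p]₂`. -/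
def proj (K : M.circles) (i : Fin 2) (p : P) : P :=
  (M.H3 i _ (M.gen_mem i p) K.1 K.2).choose

theorem proj_mem_gen (K : M.circles) (i : Fin 2) (p : P) : M.proj K i p ∈ M.gen i p :=
  (M.H3 i _ (M.gen_mem i p) K.1 K.2).choose_spec.1.1

theorem proj_mem (K : M.circles) (i : Fin 2) (p : P) : M.proj K i p ∈ K.1 :=
  (M.H3 i _ (M.gen_mem i p) K.1 K.2).choose_spec.1.2

theorem eq_proj {K : M.circles} {i : Fin 2} {p x : P} (hg : x ∈ M.gen i p) (hK : x ∈ K.1) :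
    x = M.proj K i p :=
  (M.H3 i _ (M.gen_mem i p) K.1 K.2).choose_spec.2 x ⟨hg, hK⟩

/-- The point `S_K(p)` symmetric to `p` with respect to the circle `K`. -/
def circleSymm (K : M.circles) (p : P) : P := M.corner (M.proj K 1 p) (M.proj K 0 p)

/-- `S_K(p)` is the unique point `q` such that `pq` and `qp` lie on `K`. -/
theorem eq_circleSymm_iff (K : M.circles) (p q : P) :
    q = M.circleSymm K p ↔ M.corner p q ∈ K.1 ∧ M.corner q p ∈ K.1 := by
  constructor
  · rintro rfl
    have h0 := M.gen_eq_of_mem (M.corner_mem_left (M.proj K 1 p) (M.proj K 0 p))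
    have h1 := M.gen_eq_of_mem (M.corner_mem_right (M.proj K 1 p) (M.proj K 0 p))
    constructor
    · rw [← M.eq_corner (M.proj_mem_gen K 0 p)
        (by rw [circleSymm, h1]; exact M.mem_gen 1 _)]
      exact M.proj_mem K 0 p
    · rw [← M.eq_corner (q := p) (x := M.proj K 1 p)
        (by rw [circleSymm, h0]; exact M.mem_gen 0 _) (M.proj_mem_gen K 1 p)]
      exact M.proj_mem K 1 p
  · rintro ⟨h0, h1⟩
    have e0 := M.eq_proj (M.corner_mem_left p q) h0
    have e1 := M.eq_proj (M.corner_mem_right q p) h1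
    apply M.eq_corner
    · rw [← e1, M.gen_eq_of_mem (M.corner_mem_left q p)]
      exact M.mem_gen 0 q
    · rw [← e0, M.gen_eq_of_mem (M.corner_mem_right p q)]
      exact M.mem_gen 1 q

/-- `K ⊥ L`: the circles are different and `S_K` maps `L` into `L`. -/
def Orthogonal (K L : M.circles) : Prop :=
  K ≠ L ∧ ∀ p ∈ L.1, M.circleSymm K p ∈ L.1

/-- The symmetry axiom (S). -/
def SymmetryAxiom : Prop :=
  ∀ (K L : M.circles) (p : P), p ∈ L.1 → p ∉ K.1 → M.circleSymm K p ∈ L.1 → M.Orthogonal K L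

def Concyclic (X : Set P) : Prop := ∃ K ∈ M.circles, X ⊆ K

/-- The rectangle axiom (G). -/
def RectangleAxiom : Prop :=
  ∀ p q : Fin 4 → P, Function.Injective p → Function.Injective q →
    M.Concyclic (Set.range p) → M.Concyclic (Set.range q) →
    M.Concyclic (Set.range fun i => M.corner (p i) (q i)) →
    M.Concyclic (Set.range fun i => M.corner (q i) (p i))

theorem proj_proj_cancel (E K : M.circles) {i j : Fin 2} {x : P} (hx : x ∈ E.1) :
    M.proj E i (M.proj K j (M.proj E j (M.proj K i x))) = x := by
  have a : M.proj K i x = M.proj K j (M.proj E j (M.proj K i x)) := by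
    apply M.eq_proj _ (M.proj_mem K i x)
    rw [M.gen_eq_of_mem (M.proj_mem_gen E j _)]
    exact M.mem_gen j _
  rw [← a]
  symm
  apply M.eq_proj _ hx
  rw [M.gen_eq_of_mem (M.proj_mem_gen K i x)]
  exact M.mem_gen i x

/-- The permutation `f_K` of the points of the circle `E` with `f_K(x) = (Kx)E`. -/
def circlePerm (E K : M.circles) : Equiv.Perm E.1 where
  toFun x := ⟨M.proj E 0 (M.proj K 1 x), M.proj_mem E 0 _⟩
  invFun x := ⟨M.proj E 1 (M.proj K 0 x), M.proj_mem E 1 _⟩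
  left_inv x := Subtype.ext (M.proj_proj_cancel E K x.2)
  right_inv x := Subtype.ext (M.proj_proj_cancel E K x.2)

/-- The permutation set `{f_K | K a circle}` on `E` is closed under composition. -/
def PermSetClosed (E : M.circles) : Prop :=
  ∀ f ∈ Set.range (M.circlePerm E), ∀ g ∈ Set.range (M.circlePerm E),
    f * g ∈ Set.range (M.circlePerm E)

end

end HyperbolaStructure

/-!
Fix a circle `E`. A point is determined by its two coordinates on `E`, so that circles become the
graphs of permutations of `E`: the point `corner y x` lies on `K` exactly when `f_K x = y`
(`corner_mem_iff`). By (H4) the set `S` of these permutations is sharply 3-transitive, and it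
contains the identity `f_E`. Axiom (G) says that `g * h⁻¹ * f` agrees with members of `S` at any
four points, for all `f, g, h ∈ S`; by sharpness it then belongs to `S`. Since a sharply
3-transitive set closed under composition is closed under inverses, (G) is equivalent to closure
under composition.

Axiom (S) says that `f⁻¹ * g` is an involution as soon as it interchanges two points
(`f, g ∈ S`). This property passes to every left translate `f⁻¹ S`, so each statement below holds
for all of them. That `S` is a group is deduced from stabilizers of increasing size.

* The stabilizer of two points `x, y` is inverted by every member of `S` interchanging `x` and `y`.
  The products of two such members form a transitive family that commutes with the stabilizer, and
  a permutation commuting with that family is determined by one value; hence the stabilizer is a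
  group (`stabilizer_group`).
* The circles touching `E` at the point `o` of `E`, that is, the permutations in `S` whose only
  fixed point is `o`, together with the identity, are shown in the same way to form an abelian group
  `W`, regular on `E \ {o}` (`parabolic_structure`). The transitive family comes from the
  involutions in `S` fixing `o`. As in the distinction of the characteristic of a field, these
  either all have a second fixed point, or never have one; in the latter case they themselves make
  up `W` without the identity.
* The circles through the point `o` of `E` are the lines of an affine plane, and conjugation with
  elements of `W` gives its translations in one direction. Translations in different directions
  commute (`translations_commute_at`), so `S` and `h⁻¹ S` have the same group `W` for every `h`
  fixing `o`, and the stabilizer of `o` is closed under composition (`stabilizer_mul_mem`).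
* Applied to `h⁻¹ S`, this shows that the condition `h * j ∈ S`, for `j` fixing two points, depends
  only on the value of `h` at either of these points, and changing the values one at a time proves
  it for all `h` (`mul_mem_of_fixed_pair`). If `E` has at least four points, every member of `S` is
  a product of elements with two fixed points; if it has three, `S` is the full symmetric group
  (`mul_mem`).
-/

open Equiv

/-! ### Symmetric sharply 3-transitive sets of permutations -/

/-- A set of permutations that contains the identity and is sharply 3-transitive on a set with at
least three elements. -/
structure IsSharplyThreeTransitive {E : Type*} (S : Set (Perm E)) : Prop where
  one_mem : 1 ∈ S
  exists_three : ∃ a b c : E, a ≠ b ∧ a ≠ c ∧ b ≠ c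
  exists_map : ∀ {a b c a' b' c' : E}, a ≠ b → a ≠ c → b ≠ c → a' ≠ b' → a' ≠ c' → b' ≠ c' →
    ∃ f ∈ S, f a = a' ∧ f b = b' ∧ f c = c'
  eq_of_agree : ∀ {f g : Perm E}, f ∈ S → g ∈ S → ∀ {a b c : E}, a ≠ b → a ≠ c → b ≠ c →
    f a = g a → f b = g b → f c = g c → f = g

/-- A sharply 3-transitive set in which a quotient `f⁻¹ * g` that interchanges two distinct points
is an involution (or trivial); the latter is written as `g * f⁻¹ * g = f`. -/
structure IsSymmetricSet {E : Type*} (S : Set (Perm E)) : Prop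
    extends IsSharplyThreeTransitive S where
  symm : ∀ {f g : Perm E}, f ∈ S → g ∈ S → ∀ {a b : E}, a ≠ b → g a = f b → g b = f a →
    g * f⁻¹ * g = f

/-- The left translate `f⁻¹ S`. -/
def leftTranslate {E : Type*} (S : Set (Perm E)) (f : Perm E) : Set (Perm E) := {k | f * k ∈ S}

/-- The members of `S` that fix `o`, and no other point unless they are the identity: the circles
that touch the identity at `(o, o)`. -/
def parabolic {E : Type*} (S : Set (Perm E)) (o : E) : Set (Perm E) :=
  {k | k ∈ S ∧ k o = o ∧ (k = 1 ∨ ∀ y, y ≠ o → k y ≠ y)}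

/-- The involutions in `S` that fix `o`. -/
def involutionsFixing {E : Type*} (S : Set (Perm E)) (o : E) : Set (Perm E) :=
  {k | k ∈ S ∧ k o = o ∧ k * k = 1 ∧ k ≠ 1}

/-- A permutation supported on `F` that commutes with a family transitive on `F` is determined by
one value, so it belongs to any transitive family with the same two properties. -/
theorem mem_of_commute_of_transitive {E : Type*} {F : Set E} {W T : Set (Perm E)}
    (hW : ∀ w ∈ W, ∀ x ∉ F, w x = x) (hcomm : ∀ w ∈ W, ∀ t ∈ T, w * t = t * w)
    (hTt : ∀ a ∈ F, ∀ b ∈ F, ∃ t ∈ T, t a = b) (hWt : ∀ a ∈ F, ∀ b ∈ F, ∃ w ∈ W, w a = b)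
    (hF : F.Nonempty) {k : Perm E} (hk : ∀ x ∉ F, k x = x) (hkT : ∀ t ∈ T, k * t = t * k) :
    k ∈ W := by
  obtain ⟨b, hb⟩ := hF
  have hkb : k b ∈ F := by
    by_contra h
    exact h (by rw [k.injective (hk _ h)]; exact hb)
  obtain ⟨w, hw, hwb⟩ := hWt b hb _ hkb
  suffices k = w by rwa [this]
  ext c
  by_cases hc : c ∈ F
  · obtain ⟨t, ht, rfl⟩ := hTt b hb c hc
    have h1 := DFunLike.congr_fun (hkT t ht) b
    have h2 := DFunLike.congr_fun (hcomm w hw t ht) b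
    simp only [Perm.mul_apply] at h1 h2
    rw [h1, h2, hwb]
  · rw [hk c hc, hW w hw c hc]

theorem IsSharplyThreeTransitive.eq_one {E : Type*} {S : Set (Perm E)}
    (hS : IsSharplyThreeTransitive S) {f : Perm E} (hf : f ∈ S) {a b c : E}
    (hab : a ≠ b) (hac : a ≠ c) (hbc : b ≠ c) (ha : f a = a) (hb : f b = b) (hc : f c = c) :
    f = 1 :=
  hS.eq_of_agree hf hS.one_mem hab hac hbc ha hb hc

theorem IsSharplyThreeTransitive.exists_ne_ne {E : Type*} {S : Set (Perm E)}
    (hS : IsSharplyThreeTransitive S) (x y : E) : ∃ z, z ≠ x ∧ z ≠ y := by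
  obtain ⟨a, b, c, hab, hac, hbc⟩ := hS.exists_three
  by_contra! h
  have ha := h a
  have hb := h b
  have hc := h c
  by_cases a = x <;> by_cases b = x <;> by_cases c = x <;> simp_all

namespace IsSymmetricSet

variable {E : Type*} {S : Set (Perm E)}

theorem isSymmetricSet_leftTranslate (hS : IsSymmetricSet S) {f : Perm E} (hf : f ∈ S) :
    IsSymmetricSet (leftTranslate S f) where
  one_mem := by simpa [leftTranslate] using hf
  exists_three := hS.exists_three
  exists_map := by
    intro a b c a' b' c' h1 h2 h3 h4 h5 h6
    obtain ⟨g, hg, ha, hb, hc⟩ := hS.exists_map h1 h2 h3 (f.injective.ne h4) (f.injective.ne h5)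
      (f.injective.ne h6)
    exact ⟨f⁻¹ * g, by simpa [leftTranslate] using hg, by simp [ha], by simp [hb],
      by simp [hc]⟩
  eq_of_agree := by
    intro k l hk hl a b c h1 h2 h3 ha hb hc
    exact mul_left_cancel (hS.eq_of_agree hk hl h1 h2 h3 (by simp [ha]) (by simp [hb])
      (by simp [hc]))
  symm := by
    intro k l hk hl a b hab h1 h2
    have := hS.symm hk hl hab (by simp [h1]) (by simp [h2])
    apply mul_left_cancel (a := f)
    rw [← this]
    group

theorem mul_self (hS : IsSymmetricSet S) {f : Perm E} (hf : f ∈ S) {a b : E} (hab : a ≠ b)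
    (h1 : f a = b) (h2 : f b = a) : f * f = 1 := by
  simpa using hS.symm hS.one_mem hf hab (by simpa using h1) (by simpa using h2)

/-- An involution `r` such that `r * g` interchanges two points inverts `g`. -/
theorem inverts (hS : IsSymmetricSet S) {r g : Perm E} (hr : r ∈ S) (hrr : r * r = 1) (hg : g ∈ S)
    {a b : E} (hab : a ≠ b) (h1 : r (g a) = b) (h2 : r (g b) = a) : r * g * r = g⁻¹ := by
  have hr' : r⁻¹ = r := inv_eq_of_mul_eq_one_left hrr
  have hinv : ∀ x, r (r x) = x := fun x => DFunLike.congr_fun hrr x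
  have h := hS.symm hr hg hab (by rw [← h1, hinv]) (by rw [← h2, hinv])
  rw [hr'] at h
  rw [eq_inv_iff_mul_eq_one]
  calc r * g * r * g = r * (g * r * g) := by group
    _ = 1 := by rw [h, hrr]

theorem inverts_of_swap (hS : IsSymmetricSet S) {x y : E} (hxy : x ≠ y) {r g : Perm E}
    (hr : r ∈ S) (hrx : r x = y) (hry : r y = x) (hg : g ∈ S) (hgx : g x = x) (hgy : g y = y) :
    r * g * r = g⁻¹ :=
  hS.inverts hr (hS.mul_self hr hxy hrx hry) hg hxy (by rw [hgx, hrx]) (by rw [hgy, hry])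

end IsSymmetricSet

/-! ### Elements inverted by involutions -/

/-- The product of two permutations inverting `g` commutes with `g`. -/
theorem commute_of_inverts {G : Type*} [Group G] {r s g : G} (hss : s * s = 1)
    (h1 : r * g * r = g⁻¹) (hrr : r * r = 1) (h2 : s * g * s = g⁻¹) :
    g * (r * s) = r * s * g := by
  have hs' : s⁻¹ = s := inv_eq_of_mul_eq_one_left hss
  have e1 : r * g⁻¹ * r = g := by rw [← h1]; simp only [mul_assoc, hrr]; simp [← mul_assoc, hrr]
  calc g * (r * s) = r * g⁻¹ * r * (r * s) := by rw [e1]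
    _ = r * g⁻¹ * (r * r) * s := by group
    _ = r * (s * g * s) * s := by rw [hrr, h2, mul_one]
    _ = r * s * g * (s * s) := by group
    _ = r * s * g := by rw [hss, mul_one]

/-- An element of order two inverting `g` maps fixed points of `g` to fixed points of `g`. -/
theorem apply_fixed_of_inverts {E : Type*} {r g : Perm E} (hrr : r * r = 1)
    (h : r * g * r = g⁻¹) {x : E} (hx : g x = x) : g (r x) = r x := by
  have hinv : ∀ x, r (r x) = x := fun x => DFunLike.congr_fun hrr x
  have := DFunLike.congr_fun h x
  simp only [Perm.mul_apply] at this
  rw [Perm.inv_eq_iff_eq.2 hx.symm] at this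
  rw [← hinv (g (r x)), this]

namespace IsSymmetricSet

variable {E : Type*} {S : Set (Perm E)}

/-- The stabilizer of two points in `S` is a group, since it consists of the permutations that fix
`x` and `y` and commute with every product of two members of `S` interchanging `x` and `y`. -/
theorem stabilizer_group (hS : IsSymmetricSet S) {x y : E} (hxy : x ≠ y) :
    (∀ g ∈ S, g x = x → g y = y → ∀ h ∈ S, h x = x → h y = y → g * h ∈ S) ∧
      ∀ g ∈ S, g x = x → g y = y → g⁻¹ ∈ S := by
  set W : Set (Perm E) := {g | g ∈ S ∧ g x = x ∧ g y = y}
  set T : Set (Perm E) := {t | ∃ r ∈ S, ∃ s ∈ S, (r x = y ∧ r y = x) ∧ (s x = y ∧ s y = x) ∧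
    t = r * s}
  have hcomm : ∀ w ∈ W, ∀ t ∈ T, w * t = t * w := by
    rintro w ⟨hw, hwx, hwy⟩ t ⟨r, hr, s, hs, ⟨hrx, hry⟩, ⟨hsx, hsy⟩, rfl⟩
    exact commute_of_inverts (hS.mul_self hs hxy hsx hsy)
      (hS.inverts_of_swap hxy hr hrx hry hw hwx hwy) (hS.mul_self hr hxy hrx hry)
      (hS.inverts_of_swap hxy hs hsx hsy hw hwx hwy)
  have key : ∀ k : Perm E, k x = x → k y = y → (∀ t ∈ T, k * t = t * k) → k ∈ S := by
    intro k hkx hky hk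
    refine (mem_of_commute_of_transitive (F := {z | z ≠ x ∧ z ≠ y}) (W := W) (T := T)
      ?_ hcomm ?_ ?_ (hS.exists_ne_ne x y) ?_ hk).1
    · rintro w ⟨-, hwx, hwy⟩ z hz
      simp only [Set.mem_ofPred_eq, not_and_or, not_not] at hz
      rcases hz with rfl | rfl <;> assumption
    · rintro a ⟨hax, hay⟩ b ⟨hbx, hby⟩
      obtain ⟨s, hs, hsx, hsy, hsa⟩ := hS.exists_map hxy hax.symm hay.symm hxy.symm hay.symm hax.symm
      obtain ⟨r, hr, hrx, hry, hra⟩ := hS.exists_map hxy hax.symm hay.symm hxy.symm hby.symm hbx.symm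
      exact ⟨r * s, ⟨r, hr, s, hs, ⟨hrx, hry⟩, ⟨hsx, hsy⟩, rfl⟩, by simp [hsa, hra]⟩
    · rintro a ⟨hax, hay⟩ b ⟨hbx, hby⟩
      obtain ⟨w, hw, hwx, hwy, hwa⟩ := hS.exists_map hxy hax.symm hay.symm hxy hbx.symm hby.symm
      exact ⟨w, ⟨hw, hwx, hwy⟩, hwa⟩
    · intro z hz
      simp only [Set.mem_ofPred_eq, not_and_or, not_not] at hz
      rcases hz with rfl | rfl <;> assumption
  constructor
  · intro g hg hgx hgy h hh hhx hhy
    refine key _ (by simp [hgx, hhx]) (by simp [hgy, hhy]) fun t ht => ?_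
    rw [mul_assoc, hcomm h ⟨hh, hhx, hhy⟩ t ht, ← mul_assoc, hcomm g ⟨hg, hgx, hgy⟩ t ht, mul_assoc]
  · intro g hg hgx hgy
    refine key _ (Perm.inv_eq_iff_eq.2 hgx.symm) (Perm.inv_eq_iff_eq.2 hgy.symm) fun t ht => ?_
    exact (Commute.inv_left (a := g) (b := t) (hcomm g ⟨hg, hgx, hgy⟩ t ht) : _)

theorem involution_unique (hS : IsSymmetricSet S) {x y : E} (hxy : x ≠ y) {s t : Perm E}
    (hs : s ∈ involutionsFixing S x) (ht : t ∈ involutionsFixing S x)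
    (hsy : s y = y) (hty : t y = y) : s = t := by
  obtain ⟨hsS, hsx, hss, hs1⟩ := hs
  obtain ⟨htS, htx, htt, ht1⟩ := ht
  obtain ⟨a, hax, hay⟩ := hS.exists_ne_ne x y
  -- The involution interchanging `x`, `y` and fixing `a` commutes with `s` and `t`, so it also
  -- fixes `s a` and `t a`; it has at most two fixed points.
  obtain ⟨r, hr, hrx, hry, hra⟩ := hS.exists_map hxy hax.symm hay.symm hxy.symm hay.symm hax.symm
  have hrr := hS.mul_self hr hxy hrx hry
  have fix : ∀ u ∈ S, u x = x → u y = y → u * u = 1 → r (u a) = u a := by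
    intro u hu hux huy huu
    have h := hS.inverts_of_swap hxy hr hrx hry hu hux huy
    rw [inv_eq_of_mul_eq_one_left huu] at h
    have := DFunLike.congr_fun h a
    simpa [hra] using this
  have hsa := fix s hsS hsx hsy hss
  have hta := fix t htS htx hty htt
  have hsa' : a ≠ s a := fun h => hs1 (hS.eq_one hsS hxy hax.symm hay.symm hsx hsy h.symm)
  have hta' : a ≠ t a := fun h => ht1 (hS.eq_one htS hxy hax.symm hay.symm htx hty h.symm)
  by_cases h : s a = t a
  · exact hS.eq_of_agree hsS htS hxy hax.symm hay.symm (by rw [hsx, htx]) (by rw [hsy, hty]) h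
  · have := hS.eq_one hr hsa' hta' h hra hsa hta
    rw [this] at hrx
    exact absurd hrx hxy

/-- If `f` has the only fixed point `o` and is not an involution, then the involution interchanging
`f⁻¹ u` and `f u` and fixing `u` inverts `f`, and therefore fixes `o`. -/
theorem exists_involution_inverting (hS : IsSymmetricSet S) {o : E} {f : Perm E} (hf : f ∈ S)
    (hfo : f o = o) (hfix : ∀ y, y ≠ o → f y ≠ y) (hff : f * f ≠ 1) {u : E} (hu : u ≠ o) :
    ∃ t ∈ involutionsFixing S o, t u = u ∧ t * f * t = f⁻¹ := by
  obtain ⟨a, rfl⟩ := f.surjective u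
  have hao : a ≠ o := by rintro rfl; exact hu hfo
  have h1 : a ≠ f a := (hfix a hao).symm
  have h2 : a ≠ f (f a) := fun h => hff (hS.mul_self hf h1 rfl h.symm)
  have h3 : f a ≠ f (f a) := (hfix _ hu).symm
  obtain ⟨t, ht, hta, htc, htu⟩ := hS.exists_map h2 h1 h3.symm h2.symm h3.symm h1
  have htt := hS.mul_self ht h2 hta htc
  have hinv := hS.inverts ht htt hf h1 htu htc
  refine ⟨t, ⟨ht, ?_, htt, ?_⟩, htu, hinv⟩
  · by_contra h
    exact hfix _ h (apply_fixed_of_inverts htt hinv hfo)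
  · rintro rfl
    exact h2 hta

/-- An involution fixing `o` and `b` yields non-involutory elements with the only fixed point `o`,
with a prescribed value at `b`: the circles through `(o, o)` orthogonal to it. -/
theorem exists_parabolic_of_involution (hS : IsSymmetricSet S) {o a b : E} {s : Perm E}
    (hs : s ∈ involutionsFixing S o) (hbo : b ≠ o) (hsb : s b = b) (hao : a ≠ o) (hab : a ≠ b) :
    ∃ f ∈ S, f o = o ∧ (∀ y, y ≠ o → f y ≠ y) ∧ f * f ≠ 1 ∧ f b = a := by
  obtain ⟨hsS, hso, hss, hs1⟩ := hs
  have hinv : ∀ x, s (s x) = x := fun x => DFunLike.congr_fun hss x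
  have hfixs : ∀ y, s y = y → y = o ∨ y = b := by
    intro y hy
    by_contra! h
    exact hs1 (hS.eq_one hsS hbo.symm h.1.symm h.2.symm hso hsb hy)
  have hsao : s a ≠ o := fun h => hao (by rw [← hinv a, h, hso])
  have hsab : s a ≠ b := fun h => hab (by rw [← hinv a, h, hsb])
  have hsaa : s a ≠ a := fun h => (hfixs a h).elim hao hab
  obtain ⟨f, hf, hfo, hfb, hfa⟩ := hS.exists_map hbo.symm hsao.symm hsab.symm hao.symm hbo.symm hab
  have hsf := hS.inverts hsS hss hf hsab.symm (by rw [hfb]) (by rw [hfa, hsb])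
  refine ⟨f, hf, hfo, fun y hy hfy => ?_, fun hff => ?_, hfb⟩
  · have hfsy := apply_fixed_of_inverts hss hsf hfy
    by_cases h : s y = y
    · rcases hfixs y h with rfl | rfl
      · exact hy rfl
      · exact hab (hfb.symm.trans hfy)
    · have hsyo : s y ≠ o := fun h => hy (by rw [← hinv y, h, hso])
      have := hS.eq_one hf hy.symm hsyo.symm (Ne.symm h) hfo hfy hfsy
      rw [this] at hfb
      exact hab hfb.symm
  · have := DFunLike.congr_fun hff (s a)
    simp only [Perm.mul_apply, hfa, hfb, Perm.one_apply] at this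
    exact hsaa this.symm

theorem exists_involution_fixing (hS : IsSymmetricSet S) {o b u : E} {s : Perm E}
    (hs : s ∈ involutionsFixing S o) (hbo : b ≠ o) (hsb : s b = b) (hu : u ≠ o) :
    ∃ t ∈ involutionsFixing S o, t u = u := by
  obtain ⟨a, hao, hab⟩ := hS.exists_ne_ne o b
  obtain ⟨f, hf, hfo, hfix, hff, -⟩ := hS.exists_parabolic_of_involution hs hbo hsb hao hab
  obtain ⟨t, ht, htu, -⟩ := hS.exists_involution_inverting hf hfo hfix hff hu
  exact ⟨t, ht, htu⟩

theorem exists_involution_map (hS : IsSymmetricSet S) {o a b : E} (hao : a ≠ o) (hbo : b ≠ o)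
    (hab : a ≠ b) : ∃ s ∈ involutionsFixing S o, s a = b := by
  obtain ⟨s, hs, hso, hsa, hsb⟩ := hS.exists_map hao.symm hbo.symm hab hbo.symm hao.symm hab.symm
  refine ⟨s, ⟨hs, hso, hS.mul_self hs hab hsa hsb, ?_⟩, hsa⟩
  rintro rfl
  exact hab hsa

theorem involution_eq_of_map (hS : IsSymmetricSet S) {o a : E} (hao : a ≠ o) {s t : Perm E}
    (hs : s ∈ involutionsFixing S o) (ht : t ∈ involutionsFixing S o) (h : s a = t a) :
    s = t := by
  by_cases hsa : s a = a
  · exact hS.involution_unique hao.symm hs ht hsa (h ▸ hsa)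
  · have hss : s (s a) = a := DFunLike.congr_fun hs.2.2.1 a
    have htt : t (t a) = a := DFunLike.congr_fun ht.2.2.1 a
    have hsao : s a ≠ o := fun h' => hao (by rw [← hss, h', hs.2.1])
    exact hS.eq_of_agree hs.1 ht.1 hao.symm hsao.symm (Ne.symm hsa) (by rw [hs.2.1, ht.2.1]) h
      (by rw [hss, h, htt])

end IsSymmetricSet

/-! ### Parabolic elements -/

namespace IsSymmetricSet

variable {E : Type*} {S : Set (Perm E)}

/-- If some involution in `S` has two fixed points, one of them `o`, then no involution in `S` has
`o` as its only fixed point. -/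
theorem mul_self_ne_one_of_parabolic (hS : IsSymmetricSet S) {o b : E} {s : Perm E}
    (hs : s ∈ involutionsFixing S o) (hbo : b ≠ o) (hsb : s b = b) {f : Perm E} (hf : f ∈ S)
    (hfo : f o = o) (hfix : ∀ y, y ≠ o → f y ≠ y) : f * f ≠ 1 := by
  intro hff
  have hzb : f b ≠ b := hfix b hbo
  have hzo : f b ≠ o := fun h => hbo (f.injective (h.trans hfo.symm))
  -- An involution `t` fixing `b` and `f b` is inverted by `f`, hence commutes with it, so `f` also
  -- fixes `t o`.
  obtain ⟨t, ⟨ht, htb, htt, ht1⟩, htz⟩ := hS.exists_involution_fixing (o := b) (b := o)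
    ⟨hs.1, hsb, hs.2.2⟩ hbo.symm hs.2.1 hzb
  have hfb : f (f b) = b := DFunLike.congr_fun hff b
  have h := hS.inverts_of_swap hzb.symm hf rfl hfb ht htb htz
  rw [inv_eq_of_mul_eq_one_left htt] at h
  have hto : f (t o) = t o := by
    have := DFunLike.congr_fun h o
    simpa [hfo] using this
  have hto' : t o ≠ o := fun h => ht1 (hS.eq_one ht hzb.symm hbo hzo htb htz h)
  exact hfix _ hto' hto

theorem parabolic_structure_of_fixed (hS : IsSymmetricSet S) {o b : E} {s : Perm E}
    (hs : s ∈ involutionsFixing S o) (hbo : b ≠ o) (hsb : s b = b) :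
    (∀ w ∈ parabolic S o, ∀ v ∈ parabolic S o, w * v = v * w) ∧
      (∀ a, a ≠ o → ∀ c, c ≠ o → ∃ w ∈ parabolic S o, w a = c) ∧
      ∀ w ∈ parabolic S o, w ∈ Subgroup.closure (involutionsFixing S o) := by
  have hfixed : ∀ u, u ≠ o → ∃ t ∈ involutionsFixing S o, t u = u :=
    fun u hu => hS.exists_involution_fixing hs hbo hsb hu
  have hinv : ∀ w ∈ parabolic S o, ∀ t ∈ involutionsFixing S o, t * w * t = w⁻¹ := by
    rintro w ⟨hw, hwo, rfl | hwfix⟩ t ht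
    · simp [ht.2.2.1]
    · have hww := hS.mul_self_ne_one_of_parabolic hs hbo hsb hw hwo hwfix
      have : ∃ u, u ≠ o ∧ t u = u := by
        by_contra! h
        exact hS.mul_self_ne_one_of_parabolic hs hbo hsb ht.1 ht.2.1 h ht.2.2.1
      obtain ⟨u, hu, htu⟩ := this
      obtain ⟨t', ht', htu', h⟩ := hS.exists_involution_inverting hw hwo hwfix hww hu
      rwa [hS.involution_unique hu.symm ht ht' htu htu']
  have htrans : ∀ a, a ≠ o → ∀ c, c ≠ o → ∃ w ∈ parabolic S o, w a = c := by
    intro a ha c hc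
    by_cases hac : c = a
    · exact ⟨1, ⟨hS.one_mem, rfl, Or.inl rfl⟩, hac.symm⟩
    · obtain ⟨t, ht, hta⟩ := hfixed a ha
      obtain ⟨f, hf, hfo, hfix, -, hfa⟩ := hS.exists_parabolic_of_involution ht ha hta hc hac
      exact ⟨f, ⟨hf, hfo, Or.inr hfix⟩, hfa⟩
  set T : Set (Perm E) := {t | ∃ r ∈ involutionsFixing S o, ∃ s ∈ involutionsFixing S o, t = r * s}
  have hcomm : ∀ w ∈ parabolic S o, ∀ t ∈ T, w * t = t * w := by
    rintro w hw t ⟨r, hr, s, hs, rfl⟩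
    exact commute_of_inverts hs.2.2.1 (hinv w hw r hr) hr.2.2.1 (hinv w hw s hs)
  have hTtrans : ∀ a, a ≠ o → ∀ c, c ≠ o → ∃ t ∈ T, t a = c := by
    intro a ha c hc
    obtain ⟨t, ht, hta⟩ := hfixed a ha
    by_cases hac : a = c
    · exact ⟨t * t, ⟨t, ht, t, ht, rfl⟩, by rw [Perm.mul_apply, hta, hta, hac]⟩
    · obtain ⟨r, hr, hra⟩ := hS.exists_involution_map ha hc hac
      exact ⟨r * t, ⟨r, hr, t, ht, rfl⟩, by simp [hta, hra]⟩
  have hWsupp : ∀ w ∈ parabolic S o, ∀ x ∉ {z | z ≠ o}, w x = x := by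
    intro w hw x hx
    obtain rfl : x = o := by simpa using hx
    exact hw.2.1
  have hTsupp : ∀ w ∈ T, ∀ x ∉ {z | z ≠ o}, w x = x := by
    rintro w ⟨r, hr, s, hs, rfl⟩ x hx
    obtain rfl : x = o := by simpa using hx
    simp [hr.2.1, hs.2.1]
  have hmul : ∀ w ∈ parabolic S o, ∀ v ∈ parabolic S o, w * v ∈ parabolic S o := by
    intro w hw v hv
    refine mem_of_commute_of_transitive hWsupp hcomm hTtrans htrans ⟨b, hbo⟩
      (fun x hx => by simp [hWsupp w hw x hx, hWsupp v hv x hx]) fun t ht => ?_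
    rw [mul_assoc, hcomm v hv t ht, ← mul_assoc, hcomm w hw t ht, mul_assoc]
  have habel : ∀ w ∈ parabolic S o, ∀ v ∈ parabolic S o, w * v = v * w := by
    intro w hw v hv
    have h1 := hinv _ (hmul w hw v hv) s hs
    have h2 := hinv w hw s hs
    have h3 := hinv v hv s hs
    have hss := hs.2.2.1
    have : (s * w * s) * (s * v * s) = s * (w * v) * s := by
      calc (s * w * s) * (s * v * s) = s * w * (s * s) * v * s := by group
        _ = s * (w * v) * s := by rw [hss]; group
    rw [h1, h2, h3] at this
    have := congrArg (·⁻¹) this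
    simpa using this.symm
  refine ⟨habel, htrans, fun w hw => ?_⟩
  have hwT : w ∈ T := mem_of_commute_of_transitive hTsupp
    (fun t ht w hw => (hcomm w hw t ht).symm) htrans hTtrans ⟨b, hbo⟩ (hWsupp w hw)
    fun v hv => habel w hw v hv
  obtain ⟨r, hr, s, hs, rfl⟩ := hwT
  exact mul_mem (Subgroup.subset_closure hr) (Subgroup.subset_closure hs)

theorem mem_involutionsFixing_of_parabolic (hS : IsSymmetricSet S) {o : E}
    (hB : ∀ s ∈ involutionsFixing S o, ∀ b, b ≠ o → s b ≠ b) {f : Perm E}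
    (hf : f ∈ parabolic S o) (hf1 : f ≠ 1) : f ∈ involutionsFixing S o := by
  obtain ⟨hfS, hfo, h | hfix⟩ := hf
  · exact absurd h hf1
  · refine ⟨hfS, hfo, ?_, hf1⟩
    by_contra hff
    obtain ⟨b, hb, -⟩ := hS.exists_ne_ne o o
    obtain ⟨t, ht, htb, -⟩ := hS.exists_involution_inverting hfS hfo hfix hff hb
    exact hB t ht b hb htb

/-- If no involution in `S` fixes both `o` and a second point, then the same holds for `s⁻¹ S`, where
`s` is an involution in `S` fixing `o`. -/
theorem no_second_fixed_leftTranslate (hS : IsSymmetricSet S) {o : E}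
    (hB : ∀ s ∈ involutionsFixing S o, ∀ b, b ≠ o → s b ≠ b) {s : Perm E}
    (hs : s ∈ involutionsFixing S o) :
    ∀ k ∈ involutionsFixing (leftTranslate S s) o, ∀ b, b ≠ o → k b ≠ b := by
  rintro k ⟨hk, hko, hkk, hk1⟩ b hb hkb
  have hss := hs.2.2.1
  have hinv : ∀ x, s (s x) = x := fun x => DFunLike.congr_fun hss x
  set g := s * k with hg
  have hgS : g ∈ S := hk
  have hsg : s * g * s = g⁻¹ := by
    rw [eq_inv_iff_mul_eq_one, hg]
    calc s * (s * k) * s * (s * k) = (s * s) * k * (s * s) * k := by group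
      _ = 1 := by rw [hss, one_mul, mul_one, hkk]
  have hg1 : g ≠ 1 := by
    intro h
    have : s b = b := by
      have := DFunLike.congr_fun h b
      simpa [hg, hkb] using this
    exact hB s hs b hb this
  have hgo : g o = o := by simp [hg, hko, hs.2.1]
  have hgpar : g ∈ parabolic S o := by
    refine ⟨hgS, hgo, Or.inr fun y hy hgy => ?_⟩
    have hsy : s y ≠ o := fun h => hy (by rw [← hinv y, h, hs.2.1])
    exact hg1 (hS.eq_one hgS hy.symm hsy.symm (Ne.symm (hB s hs y hy)) hgo hgy
      (apply_fixed_of_inverts hss hsg hgy))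
  have hgJ := hS.mem_involutionsFixing_of_parabolic hB hgpar hg1
  have hgs : g = s := hS.involution_eq_of_map hb hgJ hs (by simp [hg, hkb])
  exact hk1 (mul_left_cancel (a := s) (by rw [← hg, hgs, mul_one]))

theorem parabolic_structure_of_not_fixed (hS : IsSymmetricSet S) {o : E}
    (hB : ∀ s ∈ involutionsFixing S o, ∀ b, b ≠ o → s b ≠ b) :
    (∀ w ∈ parabolic S o, ∀ v ∈ parabolic S o, w * v = v * w) ∧
      (∀ a, a ≠ o → ∀ c, c ≠ o → ∃ w ∈ parabolic S o, w a = c) ∧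
      ∀ w ∈ parabolic S o, w ∈ Subgroup.closure (involutionsFixing S o) := by
  refine ⟨fun w hw v hv => ?_, fun a ha c hc => ?_, fun w hw => ?_⟩
  · by_cases hw1 : w = 1
    · simp [hw1]
    by_cases hv1 : v = 1
    · simp [hv1]
    have hwJ := hS.mem_involutionsFixing_of_parabolic hB hw hw1
    have hvJ := hS.mem_involutionsFixing_of_parabolic hB hv hv1
    by_cases hwv : w = v
    · rw [hwv]
    -- Distinct involutions agree at no point but `o`, so `w⁻¹ * v` is parabolic in `w⁻¹ S`.
    have hww := hwJ.2.2.1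
    have hinv : ∀ x, w (w x) = x := fun x => DFunLike.congr_fun hww x
    have hwv1 : w * v ≠ 1 := fun h =>
      hwv (mul_left_cancel (a := w) (by rw [h, hww]))
    have hpar : w * v ∈ parabolic (leftTranslate S w) o := by
      refine ⟨?_, by simp [hw.2.1, hv.2.1], Or.inr fun y hy h => hwv ?_⟩
      · simpa [leftTranslate, ← mul_assoc, hww] using hvJ.1
      · refine hS.involution_eq_of_map hy hwJ hvJ ?_
        rw [← hinv (v y)]
        exact congrArg w h.symm
    have h := ((hS.isSymmetricSet_leftTranslate hw.1).mem_involutionsFixing_of_parabolic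
      (hS.no_second_fixed_leftTranslate hB hwJ) hpar hwv1).2.2.1
    calc w * v = (w * v)⁻¹ := (inv_eq_of_mul_eq_one_left h).symm
      _ = v⁻¹ * w⁻¹ := mul_inv_rev _ _
      _ = v * w := by
        rw [inv_eq_of_mul_eq_one_left hww, inv_eq_of_mul_eq_one_left hvJ.2.2.1]
  · by_cases hac : a = c
    · exact ⟨1, ⟨hS.one_mem, rfl, Or.inl rfl⟩, hac⟩
    · obtain ⟨s, hs, hsa⟩ := hS.exists_involution_map ha hc hac
      exact ⟨s, ⟨hs.1, hs.2.1, Or.inr (hB s hs)⟩, hsa⟩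
  · by_cases hw1 : w = 1
    · rw [hw1]; exact one_mem _
    · exact Subgroup.subset_closure (hS.mem_involutionsFixing_of_parabolic hB hw hw1)

/-- The parabolic elements form a commutative family that is transitive on the points other than
`o`, and they are products of involutions fixing `o`. -/
theorem parabolic_structure (hS : IsSymmetricSet S) (o : E) :
    (∀ w ∈ parabolic S o, ∀ v ∈ parabolic S o, w * v = v * w) ∧
      (∀ a, a ≠ o → ∀ c, c ≠ o → ∃ w ∈ parabolic S o, w a = c) ∧
      ∀ w ∈ parabolic S o, w ∈ Subgroup.closure (involutionsFixing S o) := by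
  by_cases h : ∃ s ∈ involutionsFixing S o, ∃ b, b ≠ o ∧ s b = b
  · obtain ⟨s, hs, b, hb, hsb⟩ := h
    exact hS.parabolic_structure_of_fixed hs hb hsb
  · push Not at h
    exact hS.parabolic_structure_of_not_fixed h

theorem mem_parabolic_of_commute (hS : IsSymmetricSet S) {o : E} {k : Perm E} (hk : k o = o)
    (hcomm : ∀ w ∈ parabolic S o, k * w = w * k) : k ∈ parabolic S o := by
  obtain ⟨h1, h2, -⟩ := hS.parabolic_structure o
  obtain ⟨b, hb, -⟩ := hS.exists_ne_ne o o
  refine mem_of_commute_of_transitive (F := {z | z ≠ o}) ?_ h1 h2 h2 ⟨b, hb⟩ ?_ hcomm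
  · intro w hw x hx
    obtain rfl : x = o := by simpa using hx
    exact hw.2.1
  · intro x hx
    obtain rfl : x = o := by simpa using hx
    exact hk

theorem inv_mem_parabolic (hS : IsSymmetricSet S) {o : E} {w : Perm E} (hw : w ∈ parabolic S o) :
    w⁻¹ ∈ parabolic S o :=
  hS.mem_parabolic_of_commute (Perm.inv_eq_iff_eq.2 hw.2.1.symm) fun v hv =>
    (Commute.inv_left (a := w) (b := v) ((hS.parabolic_structure o).1 w hw v hv) : _)

/-- The stabilizer of a point in `S` is closed under inverses. -/
theorem inv_mem (hS : IsSymmetricSet S) {o : E} {g : Perm E} (hg : g ∈ S) (hgo : g o = o) :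
    g⁻¹ ∈ S := by
  by_cases h : ∃ y, y ≠ o ∧ g y = y
  · obtain ⟨y, hy, hgy⟩ := h
    exact (hS.stabilizer_group hy.symm).2 g hg hgo hgy
  · push Not at h
    exact (hS.inv_mem_parabolic ⟨hg, hgo, Or.inr h⟩).1

/-- The reflection in the circle of `f`, which maps the circle of `g` to that of `f * g⁻¹ * f`,
respects the circles having a point in common with the circle of `f`. -/
theorem mul_inv_mul_mem (hS : IsSymmetricSet S) {x : E} {f g : Perm E} (hf : f ∈ S) (hg : g ∈ S)
    (hfg : f x = g x) : f * g⁻¹ * f ∈ S := by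
  have h := (hS.isSymmetricSet_leftTranslate hf).inv_mem (o := x) (g := f⁻¹ * g)
    (by simpa [leftTranslate] using hg) (by simp [← hfg])
  simpa [leftTranslate, mul_assoc] using h

/-- Translations in the direction of the identity: conjugation with a parabolic element preserves
the stabilizer of `o`. -/
theorem conj_mem (hS : IsSymmetricSet S) {o : E} {w : Perm E} (hw : w ∈ parabolic S o) :
    ∀ g ∈ S, g o = o → w * g * w⁻¹ ∈ S := by
  suffices ∀ w ∈ Subgroup.closure (involutionsFixing S o),
      ∀ g ∈ S, g o = o → w * g * w⁻¹ ∈ S ∧ (w * g * w⁻¹) o = o from fun g hg hgo =>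
    (this w ((hS.parabolic_structure o).2.2 w hw) g hg hgo).1
  have hJ : ∀ s ∈ involutionsFixing S o, ∀ g ∈ S, g o = o →
      s * g * s⁻¹ ∈ S ∧ (s * g * s⁻¹) o = o := by
    intro s hs g hg hgo
    have hs' : s⁻¹ = s := inv_eq_of_mul_eq_one_left hs.2.2.1
    rw [hs']
    refine ⟨?_, by simp [hs.2.1, hgo]⟩
    have hgo' : g⁻¹ o = o := Perm.inv_eq_iff_eq.2 hgo.symm
    have := hS.mul_inv_mul_mem (x := o) hs.1 (hS.inv_mem hg hgo) (by rw [hs.2.1, hgo'])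
    rwa [inv_inv] at this
  intro w hw
  induction hw using Subgroup.closure_induction_left with
  | one => intro g hg hgo; simpa using ⟨hg, hgo⟩
  | mul_left s hs v hv ih =>
    intro g hg hgo
    obtain ⟨h1, h2⟩ := ih g hg hgo
    have := hJ s hs _ h1 h2
    simpa [mul_assoc] using this
  | inv_mul_cancel s hs v hv ih =>
    intro g hg hgo
    obtain ⟨h1, h2⟩ := ih g hg hgo
    have hs' : s⁻¹ = s := inv_eq_of_mul_eq_one_left hs.2.2.1
    have := hJ s hs _ h1 h2
    rw [hs']
    simpa [mul_assoc] using this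

end IsSymmetricSet

/-! ### Translations commute, and the set is a group -/

namespace IsSymmetricSet

variable {E : Type*} {S : Set (Perm E)}

theorem mul_mem_parabolic (hS : IsSymmetricSet S) {o : E} {v w : Perm E} (hv : v ∈ parabolic S o)
    (hw : w ∈ parabolic S o) : v * w ∈ parabolic S o := by
  refine hS.mem_parabolic_of_commute (by simp [hv.2.1, hw.2.1]) fun u hu => ?_
  have hc := (hS.parabolic_structure o).1
  rw [mul_assoc, hc w hw u hu, ← mul_assoc, hc v hv u hu, mul_assoc]

/-- Translations in the direction of the identity map every line to a parallel line; here for a line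
that meets the identity in a point. -/
theorem conj_parallel (hS : IsSymmetricSet S) {o b : E} (hb : b ≠ o) {h w : Perm E} (hh : h ∈ S)
    (hho : h o = o) (hhb : h b = b) (hh1 : h ≠ 1) (hw : w ∈ parabolic S o) :
    h⁻¹ * (w * h * w⁻¹) ∈ parabolic (leftTranslate S h) o := by
  obtain ⟨hcomm, htrans, -⟩ := hS.parabolic_structure o
  have hk := hS.conj_mem hw h hh hho
  set k := w * h * w⁻¹ with hkdef
  have hwo : w⁻¹ o = o := Perm.inv_eq_iff_eq.2 hw.2.1.symm
  have hko : k o = o := by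
    rw [hkdef, Perm.mul_apply, hwo, Perm.mul_apply, hho, hw.2.1]
  refine ⟨by simpa [leftTranslate] using hk, ?_, ?_⟩
  · rw [Perm.mul_apply, hko, Perm.inv_eq_iff_eq, hho]
  rcases hw.2.2 with rfl | hwfix
  · left; simp [hkdef]
  right
  intro a ha hfix
  have hka : k a = h a := by rwa [Perm.mul_apply, Perm.inv_eq_iff_eq] at hfix
  -- The line in the direction of the identity through a common point `(h a, a)` of `h` and its
  -- image is fixed, so it would meet the image a second time.
  have hao : h a ≠ o := fun e => ha (h.injective (e.trans hho.symm))
  obtain ⟨w₁, hw₁, hw₁a⟩ := htrans a ha _ hao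
  have hww : w * w₁ = w₁ * w := hcomm w hw w₁ hw₁
  have hwa : w a ≠ o := fun e => ha (w.injective (e.trans hw.2.1.symm))
  have hkw : k = w₁ := by
    refine hS.eq_of_agree hk hw₁.1 ha.symm hwa.symm (hwfix a ha).symm
      (by rw [hko, hw₁.2.1]) (by rw [hka, hw₁a]) ?_
    calc k (w a) = w (h a) := by simp [hkdef]
      _ = (w * w₁) a := by rw [← hw₁a]; rfl
      _ = w₁ (w a) := by rw [hww]; rfl
  have hhw : h = w₁ := by
    calc h = w⁻¹ * k * w := by rw [hkdef]; group
      _ = w⁻¹ * (w₁ * w) := by rw [hkw, mul_assoc]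
      _ = w₁ := by rw [← hww, inv_mul_cancel_left]
  rcases hw₁.2.2 with h1 | hfix₁
  · exact hh1 (hhw.trans h1)
  · exact hfix₁ b hb (by rw [← hhw, hhb])

/-- Translations in two different directions commute, because both images of a point `(b, b)` are
the fourth vertex of the same parallelogram. -/
theorem translations_commute_at (hS : IsSymmetricSet S) {o b : E} (hb : b ≠ o) {h w v : Perm E}
    (hh : h ∈ S) (hho : h o = o) (hhb : h b = b) (hh1 : h ≠ 1) (hw : w ∈ parabolic S o)
    (hv : v ∈ parabolic (leftTranslate S h) o) : w (v b) = v (w b) := by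
  have hS' := hS.isSymmetricSet_leftTranslate hh
  have hinvb : h⁻¹ b = b := Perm.inv_eq_iff_eq.2 hhb.symm
  have hv₁ := hS.conj_parallel hb hh hho hhb hh1 hw
  have hw₁ := hS'.conj_parallel (h := h⁻¹) hb (by simpa [leftTranslate] using hS.one_mem)
    (Perm.inv_eq_iff_eq.2 hho.symm) hinvb (by simpa using hh1) hv
  have htt : leftTranslate (leftTranslate S h) h⁻¹ = S := by
    ext; simp [leftTranslate]
  rw [htt] at hw₁
  set v₁ := h⁻¹ * (w * h * w⁻¹) with hv₁def
  set w₁ := h⁻¹⁻¹ * (v * h⁻¹ * v⁻¹) with hw₁def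
  have e1 : h * v₁ * w = w * h := by rw [hv₁def]; group
  have e2 : w₁ * v = h * v * h⁻¹ := by rw [hw₁def]; group
  have hcv : v * v₁ = v₁ * v := (hS'.parabolic_structure o).1 v hv v₁ hv₁
  have hcw : w * w₁ = w₁ * w := (hS.parabolic_structure o).1 w hw w₁ hw₁
  have hs : (h * v₁) (w (v b)) = w₁ (w (v b)) := by
    calc (h * v₁) (w (v b)) = (h * v₁ * w) (v b) := rfl
      _ = w ((h * v * h⁻¹) b) := by
        rw [e1, Perm.mul_apply (h * v), hinvb]; rfl
      _ = (w * w₁) (v b) := by rw [← e2]; rfl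
      _ = w₁ (w (v b)) := by rw [hcw]; rfl
  have ht : (h * v₁) (v (w b)) = w₁ (v (w b)) := by
    calc (h * v₁) (v (w b)) = h ((v₁ * v) (w b)) := rfl
      _ = (h * v * h⁻¹) ((h * v₁ * w) b) := by rw [← hcv]; simp
      _ = (h * v * h⁻¹) (w b) := by rw [e1]; simp [hhb]
      _ = w₁ (v (w b)) := by rw [← e2]; rfl
  by_contra hne
  have hwo := hw.2.1
  have hvo := hv.2.1
  have hb' : ∀ u : Perm E, u o = o → ∀ x, x ≠ o → u x ≠ o := fun u hu x hx e =>
    hx (u.injective (e.trans hu.symm))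
  have heq : h * v₁ = w₁ := hS.eq_of_agree hv₁.1 hw₁.1 (hb' w hwo _ (hb' v hvo b hb)).symm
    (hb' v hvo _ (hb' w hwo b hb)).symm hne (by simp [hho, hv₁.2.1, hw₁.2.1]) hs ht
  have hfix : (h * v₁) (w b) = w b := by
    calc (h * v₁) (w b) = (h * v₁ * w) b := rfl
      _ = w b := by rw [e1]; simp [hhb]
  have hw₁1 : w₁ = 1 := by
    rcases hw₁.2.2 with h1 | h1
    · exact h1
    · exact absurd (heq ▸ hfix) (h1 _ (hb' w hwo b hb))
  have hv₁h : v₁ = h⁻¹ := eq_inv_of_mul_eq_one_right (heq.trans hw₁1)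
  rcases hv₁.2.2 with h1 | h1
  · exact hh1 (by rw [hv₁h] at h1; simpa using h1)
  · exact h1 b hb (by rw [hv₁h, hinvb])

/-- The parabolic elements of `S` commute with those of `h⁻¹ S`, so they belong to `h⁻¹ S`. -/
theorem mul_parabolic_mem (hS : IsSymmetricSet S) {o : E} {h w : Perm E} (hh : h ∈ S)
    (hho : h o = o) (hw : w ∈ parabolic S o) : h * w ∈ S := by
  by_cases hpar : h ∈ parabolic S o
  · exact (hS.mul_mem_parabolic hpar hw).1
  have hS' := hS.isSymmetricSet_leftTranslate hh
  suffices w ∈ parabolic (leftTranslate S h) o from this.1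
  refine hS'.mem_parabolic_of_commute hw.2.1 fun v hv => ?_
  ext b
  by_cases hb : b = o
  · simp [hb, hw.2.1, hv.2.1]
  have hinvo : h⁻¹ o = o := Perm.inv_eq_iff_eq.2 hho.symm
  have hbo : h⁻¹ b ≠ o := fun e => hb (h⁻¹.injective (e.trans hinvo.symm))
  -- Replace `h` by its parallel through `(b, b)`.
  obtain ⟨u, hu, hub⟩ := (hS'.parabolic_structure o).2.1 b hb _ hbo
  refine hS.translations_commute_at (h := h * u) hb hu.1 (by simp [hu.2.1, hho]) (by simp [hub])
    (fun e => hpar ?_) hw ⟨?_, hv.2⟩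
  · have hhu : h = u⁻¹ := eq_inv_of_mul_eq_one_left e
    exact ⟨hh, hho, by rw [hhu]; exact (hS'.inv_mem_parabolic hu).2.2⟩
  · have := (hS'.mul_mem_parabolic hu hv).1
    simpa [leftTranslate, mul_assoc] using this

/-- The stabilizer of a point in `S` is closed under multiplication. -/
theorem stabilizer_mul_mem (hS : IsSymmetricSet S) {o : E} {f g : Perm E} (hf : f ∈ S)
    (hfo : f o = o) (hg : g ∈ S) (hgo : g o = o) : f * g ∈ S := by
  have hleft : ∀ w ∈ parabolic S o, ∀ k ∈ S, k o = o → w * k ∈ S := by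
    intro w hw k hk hko
    have h1 := hS.mul_parabolic_mem (hS.inv_mem hk hko) (Perm.inv_eq_iff_eq.2 hko.symm)
      (hS.inv_mem_parabolic hw)
    have h2 := hS.inv_mem h1 (o := o) (by
      rw [Perm.mul_apply, Perm.inv_eq_iff_eq.2 hw.2.1.symm, Perm.inv_eq_iff_eq.2 hko.symm])
    simpa using h2
  by_cases hfix : ∃ b, b ≠ o ∧ g b = b
  · obtain ⟨b, hb, hgb⟩ := hfix
    have hfb : f b ≠ o := fun e => hb (f.injective (e.trans hfo.symm))
    obtain ⟨w, hw, hwb⟩ := (hS.parabolic_structure o).2.1 (f b) hfb b hb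
    have h1 := hleft w hw f hf hfo
    have h2 := (hS.stabilizer_group hb.symm).1 (w * f) h1 (by simp [hfo, hw.2.1]) (by simp [hwb])
      g hg hgo hgb
    have h3 := hleft w⁻¹ (hS.inv_mem_parabolic hw) _ h2 (by simp [hfo, hgo, hw.2.1])
    simpa [mul_assoc] using h3
  · push Not at hfix
    exact hS.mul_parabolic_mem hf hfo ⟨hg, hgo, Or.inr hfix⟩

/-- Passing to a circle with the same value at a fixed point `x` of `j` preserves the property that
multiplication by `j` stays in `S`. -/
theorem mul_mem_of_apply_eq (hS : IsSymmetricSet S) {x : E} {j h k : Perm E} (hjx : j x = x)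
    (hh : h ∈ S) (hhj : h * j ∈ S) (hk : k ∈ S) (hkx : k x = h x) : k * j ∈ S := by
  have := (hS.isSymmetricSet_leftTranslate hh).stabilizer_mul_mem (o := x) (f := h⁻¹ * k) (g := j)
    (by simpa [leftTranslate] using hk) (by simp [hkx]) hhj hjx
  simpa [leftTranslate, ← mul_assoc] using this

theorem mul_mem_of_fixed_pair (hS : IsSymmetricSet S) {x y : E} (hxy : x ≠ y) {j h : Perm E}
    (hj : j ∈ S) (hjx : j x = x) (hjy : j y = y) (hh : h ∈ S) : h * j ∈ S := by
  have hmap : ∀ {z u : E}, z ≠ u → ∃ k ∈ S, k x = z ∧ k y = u := by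
    intro z u hzu
    obtain ⟨c, hcx, hcy⟩ := hS.exists_ne_ne x y
    obtain ⟨d, hdz, hdu⟩ := hS.exists_ne_ne z u
    obtain ⟨k, hk, h1, h2, -⟩ := hS.exists_map hxy hcx.symm hcy.symm hzu hdz.symm hdu.symm
    exact ⟨k, hk, h1, h2⟩
  -- The images of `x` and `y` are changed one at a time.
  have hx : ∀ k ∈ S, k x = x → k * j ∈ S := fun k hk hkx =>
    hS.mul_mem_of_apply_eq hjx hS.one_mem (by simpa using hj) hk (by simpa using hkx)
  have hyx : ∀ k ∈ S, k y ≠ x → k * j ∈ S := by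
    intro k hk hky
    obtain ⟨l, hl, hlx, hly⟩ := hmap (Ne.symm hky)
    exact hS.mul_mem_of_apply_eq hjy hl (hx l hl hlx) hk hly.symm
  by_cases hhy : h y = x
  · have hhx : h x ≠ x := fun e => hxy (h.injective (e.trans hhy.symm))
    obtain ⟨c, hcx, hch⟩ := hS.exists_ne_ne x (h x)
    obtain ⟨l, hl, hlx, hly⟩ := hmap (Ne.symm hch)
    exact hS.mul_mem_of_apply_eq hjx hl (hyx l hl (hly ▸ hcx)) hh hlx.symm
  · exact hyx h hh hhy

/-- A symmetric sharply 3-transitive set of permutations is a group. -/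
theorem mul_mem (hS : IsSymmetricSet S) {h j : Perm E} (hh : h ∈ S) (hj : j ∈ S) : h * j ∈ S := by
  by_cases hfour : ∀ a b c : E, ∃ d, d ≠ a ∧ d ≠ b ∧ d ≠ c
  · obtain ⟨x, u, -, hxu, -, -⟩ := hS.exists_three
    have aux : ∀ p q : E, ∀ s, s ≠ p → s ≠ q → ∃ d ∈ S, d s = s ∧ d p = q ∧
        ∀ h ∈ S, h * d ∈ S ∧ h * d⁻¹ ∈ S := by
      intro p q s hsp hsq
      obtain ⟨z, hzp, hzq, hzs⟩ := hfour p q s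
      obtain ⟨d, hd, hds, hdz, hdp⟩ := hS.exists_map hzs.symm hsp hzp hzs.symm hsq hzq
      have hd' := (hS.stabilizer_group hzs.symm).2 d hd hds hdz
      exact ⟨d, hd, hds, hdp, fun h hh => ⟨hS.mul_mem_of_fixed_pair hzs.symm hd hds hdz hh,
        hS.mul_mem_of_fixed_pair hzs.symm hd' (Perm.inv_eq_iff_eq.2 hds.symm)
          (Perm.inv_eq_iff_eq.2 hdz.symm) hh⟩⟩
    -- `j` is reduced to an element with the fixed points `x` and `u`.
    obtain ⟨y, hy1, hy2, -⟩ := hfour x (j⁻¹ x) x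
    obtain ⟨d, hd, -, hdx, hdS⟩ := aux x (j⁻¹ x) y hy1 hy2
    set l := j * d with hl
    have hlS : l ∈ S := (hdS j hj).1
    have hlx : l x = x := by simp [hl, hdx]
    have hlux : l⁻¹ u ≠ x := fun e => hxu (by rw [Perm.inv_eq_iff_eq, hlx] at e; exact e.symm)
    obtain ⟨e, he, hex, heu, heS⟩ := aux u (l⁻¹ u) x hxu hlux.symm
    have hm : l * e ∈ S := (heS l hlS).1
    have h1 := hS.mul_mem_of_fixed_pair hxu hm (by simp [hex, hlx]) (by simp [heu]) hh
    have h2 := (hdS _ (heS _ h1).2).2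
    simpa [hl, mul_assoc] using h2
  · push Not at hfour
    obtain ⟨p, q, r, hpqr⟩ := hfour
    obtain ⟨a, b, c, hab, hac, hbc⟩ := hS.exists_three
    have hall : ∀ x, x = a ∨ x = b ∨ x = c := by
      have h4 : ∀ x, x = p ∨ x = q ∨ x = r := fun x => by
        by_cases h1 : x = p
        · exact Or.inl h1
        by_cases h2 : x = q
        · exact Or.inr (Or.inl h2)
        exact Or.inr (Or.inr (hpqr x h1 h2))
      intro x
      have ha := h4 a
      have hb := h4 b
      have hc := h4 c
      have hx := h4 x
      grind
    have hne := (h * j).injective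
    obtain ⟨k, hk, hka, hkb, hkc⟩ := hS.exists_map hab hac hbc (hne.ne hab) (hne.ne hac)
      (hne.ne hbc)
    suffices k = h * j by rwa [← this]
    ext x
    rcases hall x with rfl | rfl | rfl <;> assumption

end IsSymmetricSet

/-! ### Closure properties and sharp transitivity -/

namespace IsSharplyThreeTransitive

variable {E : Type*} {S : Set (Perm E)}

/-- A sharply 3-transitive set closed under multiplication is closed under inverses: the member of
`S` that undoes `f` at three points is its inverse. -/
theorem inv_mem_of_mul_mem (hS : IsSharplyThreeTransitive S)
    (hmul : ∀ f ∈ S, ∀ g ∈ S, f * g ∈ S) {f : Perm E} (hf : f ∈ S) : f⁻¹ ∈ S := by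
  obtain ⟨a, b, c, hab, hac, hbc⟩ := hS.exists_three
  obtain ⟨k, hk, ha, hb, hc⟩ := hS.exists_map (f.injective.ne hab) (f.injective.ne hac)
    (f.injective.ne hbc) hab hac hbc
  have := hS.eq_one (hmul k hk f hf) hab hac hbc ha hb hc
  rwa [← eq_inv_of_mul_eq_one_left this]

/-- A permutation that agrees at any four distinct points with a member of `S` belongs to `S`. -/
theorem mem_of_forall_four (hS : IsSharplyThreeTransitive S) {k : Perm E}
    (h : ∀ s : Fin 4 → E, Function.Injective s → ∃ f ∈ S, ∀ i, f (s i) = k (s i)) : k ∈ S := by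
  obtain ⟨a, b, c, hab, hac, hbc⟩ := hS.exists_three
  obtain ⟨f, hf, ha, hb, hc⟩ := hS.exists_map hab hac hbc (k.injective.ne hab)
    (k.injective.ne hac) (k.injective.ne hbc)
  suffices f = k by rwa [← this]
  ext x
  by_cases hx : x = a ∨ x = b ∨ x = c
  · rcases hx with rfl | rfl | rfl <;> assumption
  · push Not at hx
    obtain ⟨hxa, hxb, hxc⟩ := hx
    obtain ⟨g, hg, hgs⟩ := h ![a, b, c, x] (by
      intro i j hij
      fin_cases i <;> fin_cases j <;> simp_all [eq_comm])
    have h0 : g a = k a := hgs 0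
    have h1 : g b = k b := hgs 1
    have h2 : g c = k c := hgs 2
    have h3 : g x = k x := hgs 3
    rw [hS.eq_of_agree hf hg hab hac hbc (ha.trans h0.symm) (hb.trans h1.symm) (hc.trans h2.symm),
      h3]

end IsSharplyThreeTransitive

/-! ### Hyperbola structures in coordinates -/

namespace HyperbolaStructure

variable {P : Type*} (M : HyperbolaStructure P)

theorem gen_corner_left (p q : P) : M.gen 0 (M.corner p q) = M.gen 0 p :=
  M.gen_eq_of_mem (M.corner_mem_left p q)

theorem gen_corner_right (p q : P) : M.gen 1 (M.corner p q) = M.gen 1 q :=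
  M.gen_eq_of_mem (M.corner_mem_right p q)

theorem corner_congr {p q p' q' : P} (h0 : M.gen 0 p = M.gen 0 p') (h1 : M.gen 1 q = M.gen 1 q') :
    M.corner p q = M.corner p' q' :=
  M.eq_corner (h0 ▸ M.corner_mem_left p q) (h1 ▸ M.corner_mem_right p q)

@[simp] theorem corner_corner (a b c d : P) :
    M.corner (M.corner a b) (M.corner c d) = M.corner a d :=
  M.corner_congr (M.gen_corner_left a b) (M.gen_corner_right c d)

theorem corner_self (p : P) : M.corner p p = p :=
  (M.eq_corner (M.mem_gen 0 p) (M.mem_gen 1 p)).symm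

theorem gen_proj (K : M.circles) (i : Fin 2) (p : P) : M.gen i (M.proj K i p) = M.gen i p :=
  M.gen_eq_of_mem (M.proj_mem_gen K i p)

/-- Every point has coordinates on the circle `E`. -/
theorem eq_corner_proj (E : M.circles) (p : P) :
    p = M.corner (M.proj E 0 p) (M.proj E 1 p) := by
  rw [M.corner_congr (M.gen_proj E 0 p) (M.gen_proj E 1 p), M.corner_self]

theorem eq_of_gen_eq {E : M.circles} {i : Fin 2} {x y : P} (hx : x ∈ E.1) (hy : y ∈ E.1)
    (h : M.gen i x = M.gen i y) : x = y :=
  (M.eq_proj (h ▸ M.mem_gen i x) hx).trans (M.eq_proj (M.mem_gen i y) hy).symm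

/-- In the coordinates given by `E`, a circle is the graph of its permutation. -/
theorem corner_mem_iff (E K : M.circles) (x y : E.1) :
    M.corner y x ∈ K.1 ↔ M.circlePerm E K x = y := by
  have hval : ((M.circlePerm E K x : E.1) : P) = M.proj E 0 (M.proj K 1 x) := rfl
  rw [← Subtype.coe_inj, hval]
  constructor
  · intro h
    rw [← M.eq_proj (M.corner_mem_right y x) h]
    refine (M.eq_proj ?_ y.2).symm
    rw [M.gen_corner_left]
    exact M.mem_gen 0 _
  · intro h
    rw [← h, M.corner_congr ((M.gen_proj E 0 _)) (M.gen_proj K 1 x).symm, M.corner_self]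
    exact M.proj_mem K 1 x

theorem circlePerm_self (E : M.circles) : M.circlePerm E E = 1 := by
  ext x
  exact congrArg Subtype.val ((M.corner_mem_iff E E x x).1 (by rw [M.corner_self]; exact x.2))

theorem isSharplyThreeTransitive_range (E : M.circles) :
    IsSharplyThreeTransitive (Set.range (M.circlePerm E)) := by
  have huniq : ∀ {a b c a' b' c' : E.1}, a ≠ b → a ≠ c → b ≠ c → a' ≠ b' → a' ≠ c' → b' ≠ c' →
      ∃! C : Set P, C ∈ M.circles ∧ M.corner a' a ∈ C ∧ M.corner b' b ∈ C ∧ M.corner c' c ∈ C := by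
    intro a b c a' b' c' h1 h2 h3 h4 h5 h6
    have hne : ∀ {x y x' y' : E.1}, x ≠ y → x' ≠ y' → ∀ i : Fin 2,
        M.gen i (M.corner x' x) ≠ M.gen i (M.corner y' y) := by
      intro x y x' y' hxy hxy' i
      fin_cases i
      · change M.gen 0 _ ≠ M.gen 0 _
        rw [M.gen_corner_left, M.gen_corner_left]
        exact fun h => hxy' (Subtype.ext (M.eq_of_gen_eq x'.2 y'.2 h))
      · change M.gen 1 _ ≠ M.gen 1 _
        rw [M.gen_corner_right, M.gen_corner_right]
        exact fun h => hxy (Subtype.ext (M.eq_of_gen_eq x.2 y.2 h))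
    refine M.H4 _ _ _ (fun h => hne h1 h4 0 (by rw [h])) (fun h => hne h3 h6 0 (by rw [h]))
      (fun h => hne h2.symm h5.symm 0 (by rw [h])) ?_
    intro i A hA B hB C hC haA hbB hcC
    rw [M.eq_gen hA haA, M.eq_gen hB hbB, M.eq_gen hC hcC]
    exact ⟨hne h1 h4 i, hne h3 h6 i, hne h2.symm h5.symm i⟩
  refine ⟨⟨E, M.circlePerm_self E⟩, ?_, ?_, ?_⟩
  · obtain ⟨C, hC, a, ha, b, hb, c, hc, hab, hbc, hca⟩ := M.H5
    have hne : ∀ {x y}, x ∈ C → y ∈ C → x ≠ y →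
        (⟨M.proj E 0 x, M.proj_mem E 0 x⟩ : E.1) ≠ ⟨M.proj E 0 y, M.proj_mem E 0 y⟩ := by
      intro x y hx hy hxy h
      refine hxy (M.eq_of_gen_eq (E := ⟨C, hC⟩) (i := 0) hx hy ?_)
      rw [← M.gen_proj E 0 x, ← M.gen_proj E 0 y, Subtype.mk.inj h]
    exact ⟨_, _, _, hne ha hb hab, hne ha hc hca.symm, hne hb hc hbc⟩
  · intro a b c a' b' c' h1 h2 h3 h4 h5 h6
    obtain ⟨C, ⟨hC, ha, hb, hc⟩, -⟩ := huniq h1 h2 h3 h4 h5 h6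
    exact ⟨_, ⟨⟨C, hC⟩, rfl⟩, (M.corner_mem_iff E ⟨C, hC⟩ _ _).1 ha,
      (M.corner_mem_iff E ⟨C, hC⟩ _ _).1 hb, (M.corner_mem_iff E ⟨C, hC⟩ _ _).1 hc⟩
  · rintro _ _ ⟨K, rfl⟩ ⟨L, rfl⟩ a b c h1 h2 h3 ha hb hc
    have hi := (M.circlePerm E K).injective
    have h := (huniq h1 h2 h3 (hi.ne h1) (hi.ne h2) (hi.ne h3)).unique
      (y₁ := K.1) (y₂ := L.1)
      ⟨K.2, (M.corner_mem_iff E K _ _).2 rfl, (M.corner_mem_iff E K _ _).2 rfl,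
        (M.corner_mem_iff E K _ _).2 rfl⟩
      ⟨L.2, (M.corner_mem_iff E L _ _).2 ha.symm, (M.corner_mem_iff E L _ _).2 hb.symm,
        (M.corner_mem_iff E L _ _).2 hc.symm⟩
    rw [Subtype.ext h]

/-- In coordinates, the reflection in the circle of `f` maps `(y, x)` to `(f x, f⁻¹ y)`. -/
theorem circleSymm_corner (E K : M.circles) (x y : E.1) :
    M.circleSymm K (M.corner y x) =
      M.corner (M.circlePerm E K x) ((M.circlePerm E K)⁻¹ y : E.1) := by
  symm
  rw [M.eq_circleSymm_iff, corner_corner, corner_corner, M.corner_mem_iff E, M.corner_mem_iff E]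
  simp

theorem isSymmetricSet_range (hM : M.SymmetryAxiom) (E : M.circles) :
    IsSymmetricSet (Set.range (M.circlePerm E)) := by
  refine ⟨M.isSharplyThreeTransitive_range E, ?_⟩
  rintro _ _ ⟨K, rfl⟩ ⟨L, rfl⟩ a b hab h1 h2
  have hL : M.corner (M.circlePerm E L a) a ∈ L.1 := (M.corner_mem_iff E L _ _).2 rfl
  have hK : M.corner (M.circlePerm E L a) a ∉ K.1 := by
    rw [M.corner_mem_iff, h1]
    exact fun h => hab ((M.circlePerm E K).injective h)
  have hSL : M.circleSymm K (M.corner (M.circlePerm E L a) a) ∈ L.1 := by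
    rw [M.circleSymm_corner, h1, M.corner_mem_iff, ← h2]
    simp
  have horth := (hM K L _ hL hK hSL).2
  ext x : 1
  have := horth (M.corner (M.circlePerm E L x) x) ((M.corner_mem_iff E L _ _).2 rfl)
  rw [M.circleSymm_corner, M.corner_mem_iff] at this
  simpa using this

theorem permSetClosed_of_symmetryAxiom (hM : M.SymmetryAxiom) (E : M.circles) :
    M.PermSetClosed E :=
  fun _ hf _ hg => (M.isSymmetricSet_range hM E).mul_mem hf hg

theorem rectangleAxiom_iff_permSetClosed (E : M.circles) :
    M.RectangleAxiom ↔ M.PermSetClosed E := by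
  have hS := M.isSharplyThreeTransitive_range E
  constructor
  · rintro hG _ ⟨K, rfl⟩ _ ⟨L, rfl⟩
    set g := M.circlePerm E K
    set f := M.circlePerm E L
    refine hS.mem_of_forall_four fun s hs => ?_
    -- The four rectangles have the corners `p i = (f (s i), s i)` and
    -- `q i = (g (f (s i)), f (s i))`, and the corners `(f (s i), f (s i))` lie on `E`.
    have hinj : ∀ k : Perm E.1, ∀ u : Fin 4 → E.1, Function.Injective u →
        Function.Injective fun i => M.corner (k (u i)) (u i) := by
      intro k u hu i j hij
      refine hu (Subtype.ext (M.eq_of_gen_eq (u i).2 (u j).2 (i := 1) ?_))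
      have := congrArg (M.gen 1) hij
      simpa [M.gen_corner_right] using this
    obtain ⟨N, hN, hsub⟩ := hG (fun i => M.corner (f (s i)) (s i))
      (fun i => M.corner (g (f (s i))) (f (s i))) (hinj f s hs)
      (hinj g (fun i => f (s i)) (f.injective.comp hs))
      ⟨L.1, L.2, by rintro _ ⟨i, rfl⟩; exact (M.corner_mem_iff E L _ _).2 rfl⟩
      ⟨K.1, K.2, by rintro _ ⟨i, rfl⟩; exact (M.corner_mem_iff E K _ _).2 rfl⟩
      ⟨E.1, E.2, by rintro _ ⟨i, rfl⟩; simp [M.corner_self]⟩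
    refine ⟨_, ⟨⟨N, hN⟩, rfl⟩, fun i => (M.corner_mem_iff E ⟨N, hN⟩ _ _).1 ?_⟩
    have := hsub ⟨i, rfl⟩
    simpa using this
  · rintro hcl p q - - ⟨K, hK, hpK⟩ ⟨L, hL, hqL⟩ ⟨H, hH, hpq⟩
    set f := M.circlePerm E ⟨K, hK⟩
    set g := M.circlePerm E ⟨L, hL⟩
    set h := M.circlePerm E ⟨H, hH⟩
    obtain ⟨N, hN⟩ := hcl _ (hcl g ⟨_, rfl⟩ h⁻¹ (hS.inv_mem_of_mul_mem hcl ⟨_, rfl⟩)) f ⟨_, rfl⟩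
    refine ⟨N.1, N.2, ?_⟩
    rintro _ ⟨i, rfl⟩
    let c (j : Fin 2) (z : P) : E.1 := ⟨M.proj E j z, M.proj_mem E j z⟩
    have hc : ∀ z, z = M.corner (c 0 z) (c 1 z) := M.eq_corner_proj E
    have h1 : f (c 1 (p i)) = c 0 (p i) :=
      (M.corner_mem_iff E ⟨K, hK⟩ _ _).1 (by rw [← hc]; exact hpK ⟨i, rfl⟩)
    have h2 : g (c 1 (q i)) = c 0 (q i) :=
      (M.corner_mem_iff E ⟨L, hL⟩ _ _).1 (by rw [← hc]; exact hqL ⟨i, rfl⟩)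
    have h3 : h (c 1 (q i)) = c 0 (p i) := by
      refine (M.corner_mem_iff E ⟨H, hH⟩ _ _).1 ?_
      have := hpq ⟨i, rfl⟩
      simp only at this
      rwa [hc (p i), hc (q i), corner_corner] at this
    have hgoal : M.corner (q i) (p i) = M.corner (c 0 (q i)) (c 1 (p i)) := by
      conv_lhs => rw [hc (p i), hc (q i), corner_corner]
    change M.corner (q i) (p i) ∈ N.1
    rw [hgoal, M.corner_mem_iff, hN]
    simp [h1, ← h2, ← h3]

end HyperbolaStructure

theorem theorem4p1 {P : Type*} (M : HyperbolaStructure P) :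
    (M.SymmetryAxiom → M.RectangleAxiom ∧ ∀ E : M.circles, M.PermSetClosed E) ∧
      ∀ E : M.circles, (M.RectangleAxiom ↔ M.PermSetClosed E) := by
  refine ⟨fun hM => ⟨?_, M.permSetClosed_of_symmetryAxiom hM⟩, M.rectangleAxiom_iff_permSetClosed⟩
  obtain ⟨C, hC, -⟩ := M.H5
  exact (M.rectangleAxiom_iff_permSetClosed ⟨C, hC⟩).2 (M.permSetClosed_of_symmetryAxiom hM _)
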